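/- A (finite) cycle set is a finite set $X$ with a binary operation $\cdot$ such that $(x\cdot y)\cdot(x\cdot z)=(y\cdot x)\cdot(y\cdot z)$ for all $x,y,z\in X$, every map $\sigma_x\colon y\mapsto x\cdot y$ is bijective, and the square map $x\mapsto x\cdot x$ is bijective. It is indecomposable if it is not a disjoint union of two non-empty subsets closed under $\cdot$. Its permutation group is $\mathcal G(X)=\langle\sigma_x\mid x\in X\rangle\le\mathrm{Sym}_X$, with composition $\circ$; it carries a brace structure $(\mathcal G(X),+,\circ)$ (that is, $(\mathcal G(X),+)$ is an abelian group and $a\circ(b+c)=a\circ b-a+a\circ c$) determined by $\sigma_x^{-1}+\sigma_y^{-1}=\sigma_x^{-1}\circ\sigma_{\sigma_x(y)}^{-1}$ for $x,y\in X$. For $k\in\mathbb Z$, the $k$-cabled cycle set $(X,\cdot_k)$ is the set $X$ with the operation $x\cdot_k y=(k\sigma_x^{-1})^{-1}(y)$, where $k\sigma_x^{-1}$ is the $k$-th multiple of $\sigma_x^{-1}$ in $(\mathcal G(X),+)$ and the outer inverse is taken in $(\mathcal G(X),\circ)$. The retraction $\mathrm{Ret}(X)$ is the quotient cycle set of $X$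 by the relation $x\sim y\iff\sigma_x=\sigma_y$, and $X$ has finite multipermutation level if $|\mathrm{Ret}^m(X)|=1$ for some $m\ge 0$. **Proposition.** Let $p$ be a prime, $n \geq 0$, and let $(X,\cdot)$ be an indecomposable cycle set of order $p^n$. Let $k$ be the largest divisor of $|\mathcal G(X,\cdot)|$ that is coprime to $p$. If $(X,\cdot_k)$ has finite multipermutation level, then $\mathcal G(X,\cdot)$ is a $p$-group, and thus $k=1$. -/

import Mathlib

universe u

/-- A (non-degenerate) cycle set: a set with a binary operation `x ⬝ y` (written `op x y`) such that
`(x ⬝ y) ⬝ (x ⬝ z) = (y ⬝ x) ⬝ (y ⬝ z)`, every left translation `y ↦ x ⬝ y` is bijective and the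
square map `x ↦ x ⬝ x` is bijective. Finiteness is a separate hypothesis `[Finite X]`. -/
class CycleSet (X : Type u) where
  op : X → X → X
  cycloid : ∀ x y z : X, op (op x y) (op x z) = op (op y x) (op y z)
  bijective_left : ∀ x : X, Function.Bijective (op x)
  bijective_sq : Function.Bijective (fun x : X => op x x)

/-- A brace structure on a (multiplicatively written) group `(A, ∘)`: an abelian group structure
`(A, +)` with `a ∘ (b + c) = a ∘ b - a + a ∘ c`. -/
class Brace (A : Type u) [Group A] extends AddCommGroup A where
  mul_add_eq : ∀ a b c : A, a * (b + c) = a * b - a + a * c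

namespace CycleSet

section Basic

theorem perm_inv_apply_self {X : Type u} (f : Equiv.Perm X) (x : X) : f⁻¹ (f x) = x := f.symm_apply_apply x

theorem perm_apply_inv_self {X : Type u} (f : Equiv.Perm X) (x : X) : f (f⁻¹ x) = x := f.apply_symm_apply x

variable {X : Type u} [CycleSet X]

/-- The permutation `σ_x : y ↦ x ⬝ y`. -/
noncomputable def sigma (x : X) : Equiv.Perm X :=
  Equiv.ofBijective (op x) (bijective_left x)

@[simp] theorem sigma_apply (x y : X) : sigma x y = op x y := rfl

theorem sigma_cycloid (x y : X) :
    sigma (op x y) * sigma x = sigma (op y x) * sigma y := by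
  ext z
  exact cycloid x y z

variable (X) in
/-- The permutation group `𝒢(X) = ⟨σ_x ∣ x ∈ X⟩ ≤ Sym_X`. -/
def permGroup : Subgroup (Equiv.Perm X) :=
  Subgroup.closure (Set.range (sigma : X → Equiv.Perm X))

variable (X) in
/-- `X` is indecomposable if it is not the disjoint union of two non-empty subsets which are
closed under the cycle set operation. -/
def Indecomposable : Prop :=
  ¬ ∃ X₁ X₂ : Set X, X₁.Nonempty ∧ X₂.Nonempty ∧ Disjoint X₁ X₂ ∧ X₁ ∪ X₂ = Set.univ ∧
    (∀ x ∈ X₁, ∀ y ∈ X₁, op x y ∈ X₁) ∧ (∀ x ∈ X₂, ∀ y ∈ X₂, op x y ∈ X₂)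

/-- The canonical map `X → 𝒢(X)`, `x ↦ σ_x⁻¹`. -/
noncomputable def iota (x : X) : permGroup X :=
  ⟨(sigma x)⁻¹, inv_mem (Subgroup.subset_closure ⟨x, rfl⟩)⟩

theorem coe_iota (x : X) : ((iota x : permGroup X) : Equiv.Perm X) = (sigma x)⁻¹ := rfl

theorem iota_mul_iota (x y : X) :
    iota x * iota (op x y) = iota y * iota (op y x) := by
  apply Subtype.ext
  simp only [Subgroup.coe_mul, coe_iota, ← mul_inv_rev]
  rw [sigma_cycloid]

/-! ### The brace structure on `𝒢(X)`

The maps `T_x : g ↦ g ∘ σ_z⁻¹`, `z = g⁻¹(x)`, are pairwise commuting permutations of `𝒢(X)`, and the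
abelian group `A` they generate acts regularly on `𝒢(X)`. The addition of `𝒢(X)` is transported from
`A` along the bijection `A → 𝒢(X)`, `t ↦ t(1)`, so that `T_x` becomes the map `g ↦ g + σ_x⁻¹`. -/

/-- The permutation `T_x : g ↦ g ∘ σ_z⁻¹`, `z = g⁻¹(x)`, of `𝒢(X)`. -/
noncomputable def transl (x : X) : Equiv.Perm (permGroup X) where
  toFun g := g * iota ((g : Equiv.Perm X)⁻¹ x)
  invFun g := g * (iota ((Equiv.ofBijective _ (bijective_sq (X := X))).symm
    ((g : Equiv.Perm X)⁻¹ x)))⁻¹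
  left_inv g := by
    have h : (Equiv.ofBijective _ (bijective_sq (X := X))).symm
        (((g * iota ((g : Equiv.Perm X)⁻¹ x) : permGroup X) : Equiv.Perm X)⁻¹ x)
        = (g : Equiv.Perm X)⁻¹ x := by
      rw [Equiv.symm_apply_eq]
      simp [coe_iota]
    simp only [h, mul_inv_cancel_right]
  right_inv g := by
    set s := (Equiv.ofBijective _ (bijective_sq (X := X))) with hs
    set z := s.symm ((g : Equiv.Perm X)⁻¹ x) with hz
    have h : ((g * (iota z)⁻¹ : permGroup X) : Equiv.Perm X)⁻¹ x = z := by
      have h1 : op z z = (g : Equiv.Perm X)⁻¹ x := s.apply_symm_apply _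
      simp only [Subgroup.coe_mul, Subgroup.coe_inv, coe_iota, inv_inv, mul_inv_rev,
        Equiv.Perm.mul_apply]
      rw [← h1, Equiv.Perm.inv_eq_iff_eq]
      rfl
    change g * (iota z)⁻¹ * iota (((g * (iota z)⁻¹ : permGroup X) : Equiv.Perm X)⁻¹ x) = g
    rw [h, inv_mul_cancel_right]

theorem transl_apply (x : X) (g : permGroup X) :
    transl x g = g * iota ((g : Equiv.Perm X)⁻¹ x) := rfl

theorem transl_comm (x y : X) : transl x * transl y = (transl y * transl x : Equiv.Perm (permGroup X)) := by
  ext1 g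
  simp only [Equiv.Perm.mul_apply, transl_apply, Subgroup.coe_mul, coe_iota, mul_inv_rev, inv_inv,
    sigma_apply, mul_assoc]
  rw [iota_mul_iota]

theorem mul_transl (g h : permGroup X) (x : X) :
    g * transl x h = transl ((g : Equiv.Perm X) x) (g * h) := by
  simp [transl_apply, mul_assoc]

variable (X) in
/-- The group generated by the permutations `T_x` of `𝒢(X)`. -/
def transGroup : Subgroup (Equiv.Perm (permGroup X)) :=
  Subgroup.closure (Set.range (transl : X → Equiv.Perm (permGroup X)))

theorem transGroup_comm {s t : Equiv.Perm (permGroup X)} (hs : s ∈ transGroup X)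
    (ht : t ∈ transGroup X) : s * t = t * s := by
  have key : ∀ a ∈ Set.range (transl : X → Equiv.Perm (permGroup X)),
      ∀ b ∈ Set.range (transl : X → Equiv.Perm (permGroup X)), a * b = b * a := by
    rintro _ ⟨x, rfl⟩ _ ⟨y, rfl⟩
    exact transl_comm x y
  have := Subgroup.closure_le_centralizer_centralizer
    (Set.range (transl : X → Equiv.Perm (permGroup X)))
  have h1 : transGroup X ≤ Subgroup.centralizer (Set.range transl) := by
    refine (Subgroup.closure_le _).2 fun a ha => ?_
    rw [SetLike.mem_coe, Subgroup.mem_centralizer_iff]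
    exact fun b hb => key b hb a ha
  have h2 := Subgroup.mem_centralizer_iff.1 (this hs) t (h1 ht)
  exact h2.symm

theorem exists_trans_eq (g : permGroup X) : ∃ t ∈ transGroup X, t 1 = g := by
  have hT : ∀ x : X, transl x ∈ transGroup X := fun x => Subgroup.subset_closure ⟨x, rfl⟩
  obtain ⟨g, hg⟩ := g
  change g ∈ Subgroup.closure _ at hg
  induction hg using Subgroup.closure_induction_right with
  | one => exact ⟨1, one_mem _, rfl⟩
  | mul_right a b ha hb ih =>
    obtain ⟨x, rfl⟩ := hb
    obtain ⟨t, ht, h⟩ := ih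
    refine ⟨(transl (a (sigma x x)))⁻¹ * t, mul_mem (inv_mem (hT _)) ht, ?_⟩
    rw [Equiv.Perm.mul_apply, h, Equiv.Perm.inv_eq_iff_eq]
    have h2 : (a * sigma x)⁻¹ (a (sigma x x)) = x := by
      rw [Equiv.Perm.inv_eq_iff_eq]; rfl
    apply Subtype.ext
    simp only [transl_apply, Subgroup.coe_mul, coe_iota]
    rw [h2, mul_inv_cancel_right]
  | mul_inv_cancel a b ha hb ih =>
    obtain ⟨x, rfl⟩ := hb
    obtain ⟨t, ht, h⟩ := ih
    refine ⟨transl (a x) * t, mul_mem (hT _) ht, ?_⟩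
    rw [Equiv.Perm.mul_apply, h]
    apply Subtype.ext
    simp [transl_apply, coe_iota]

theorem bijective_eval_one :
    Function.Bijective (fun t : transGroup X => (t : Equiv.Perm (permGroup X)) 1) := by
  refine ⟨fun s t hst => ?_, fun g => ?_⟩
  · apply Subtype.ext
    ext1 g
    obtain ⟨r, hr, rfl⟩ := exists_trans_eq g
    change (s : Equiv.Perm (permGroup X)) 1 = (t : Equiv.Perm (permGroup X)) 1 at hst
    rw [← Equiv.Perm.mul_apply, ← Equiv.Perm.mul_apply, transGroup_comm s.2 hr,
      transGroup_comm t.2 hr, Equiv.Perm.mul_apply, Equiv.Perm.mul_apply, hst]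
  · obtain ⟨t, ht, h⟩ := exists_trans_eq g
    exact ⟨⟨t, ht⟩, h⟩

instance transGroupCommGroup : CommGroup (transGroup X) :=
  { (inferInstance : Group (transGroup X)) with
    mul_comm := fun s t => Subtype.ext (transGroup_comm s.2 t.2) }

/-- The bijection `𝒢(X) → A` whose inverse is `t ↦ t(1)`. -/
noncomputable def toTrans : permGroup X ≃ Additive (transGroup X) :=
  (Equiv.ofBijective _ (bijective_eval_one (X := X))).symm.trans Additive.ofMul

noncomputable instance permGroupAddCommGroup : AddCommGroup (permGroup X) :=
  (toTrans (X := X)).addCommGroup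

/-- Translation by `g`, as a permutation of `𝒢(X)`: the unique `t ∈ A` with `t(1) = g`. -/
noncomputable def transOf (g : permGroup X) : Equiv.Perm (permGroup X) :=
  ((toTrans g).toMul : transGroup X)

theorem transOf_mem (g : permGroup X) : transOf g ∈ transGroup X := (toTrans g).toMul.2

theorem transOf_one (g : permGroup X) : transOf g 1 = g :=
  (Equiv.ofBijective _ (bijective_eval_one (X := X))).apply_symm_apply g

theorem add_def (g h : permGroup X) : g + h = transOf g (transOf h 1) := rfl

theorem transOf_apply (g h : permGroup X) : transOf g h = g + h := by
  rw [add_def, transOf_one]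

theorem apply_eq_add {t : Equiv.Perm (permGroup X)} (ht : t ∈ transGroup X) (g : permGroup X) :
    t g = t 1 + g := by
  have h : transOf (t 1) = t :=
    congrArg Subtype.val (bijective_eval_one.1
      (a₁ := ⟨transOf (t 1), transOf_mem _⟩) (a₂ := ⟨t, ht⟩) (transOf_one (t 1)))
  rw [← transOf_apply, h]

theorem add_iota (g : permGroup X) (x : X) :
    g + iota x = g * iota ((g : Equiv.Perm X)⁻¹ x) := by
  have h := apply_eq_add (X := X) (Subgroup.subset_closure ⟨x, rfl⟩ : transl x ∈ transGroup X) g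
  have h1 : transl x (1 : permGroup X) = iota x := by simp [transl_apply]
  rw [add_comm, ← h1, ← h, transl_apply]

/-- The formula `σ_x⁻¹ + σ_y⁻¹ = σ_x⁻¹ ∘ σ_z⁻¹`, `z = σ_x(y)`. -/
theorem iota_add_iota (x y : X) : iota x + iota y = iota x * iota (sigma x y) := by
  rw [add_iota, coe_iota, inv_inv]

theorem mulLeft_conj_mem (g : permGroup X) {t : Equiv.Perm (permGroup X)}
    (ht : t ∈ transGroup X) :
    Equiv.mulLeft g * t * (Equiv.mulLeft g)⁻¹ ∈ transGroup X := by
  induction ht using Subgroup.closure_induction with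
  | mem t ht =>
    obtain ⟨x, rfl⟩ := ht
    have : Equiv.mulLeft g * transl x * (Equiv.mulLeft g)⁻¹ = transl ((g : Equiv.Perm X) x) := by
      rw [mul_inv_eq_iff_eq_mul]
      ext1 h
      exact mul_transl g h x
    rw [this]
    exact Subgroup.subset_closure ⟨_, rfl⟩
  | one =>
    rw [mul_one, mul_inv_cancel]
    exact one_mem _
  | mul s t _ _ hs ht =>
    have : Equiv.mulLeft g * (s * t) * (Equiv.mulLeft g)⁻¹ =
      (Equiv.mulLeft g * s * (Equiv.mulLeft g)⁻¹) * (Equiv.mulLeft g * t * (Equiv.mulLeft g)⁻¹) := by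
      group
    rw [this]
    exact mul_mem hs ht
  | inv t _ ht =>
    have : Equiv.mulLeft g * t⁻¹ * (Equiv.mulLeft g)⁻¹ =
      (Equiv.mulLeft g * t * (Equiv.mulLeft g)⁻¹)⁻¹ := by
      group
    rw [this]
    exact inv_mem ht

/-- The brace `(𝒢(X), +, ∘)`. -/
noncomputable instance permGroupBrace : Brace (permGroup X) where
  mul_add_eq a b c := by
    have key : ∀ h : permGroup X, ∀ d : permGroup X,
        (Equiv.mulLeft a * transOf h * (Equiv.mulLeft a)⁻¹) (a * d) = a * (h + d) := by
      intro h d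
      rw [Equiv.Perm.mul_apply, Equiv.Perm.mul_apply,
        show (Equiv.mulLeft a)⁻¹ (a * d) = d from inv_mul_cancel_left a d, transOf_apply]
      rfl
    have h1 := key b c
    have h2 := key b 1
    rw [apply_eq_add (mulLeft_conj_mem a (transOf_mem b))] at h1 h2
    have h3 : b + (1 : permGroup X) = b := by
      rw [← transOf_apply, transOf_one]
    rw [mul_one, h3] at h2
    rw [← h1, ← h2]
    abel

/-! ### Cabling -/

/-- The permutation `(k σ_x⁻¹)⁻¹` of `X`, where `k σ_x⁻¹` is the `k`-th power of `σ_x⁻¹` in the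
additive group of the brace `𝒢(X)` and the outer inverse is that of the group `(𝒢(X), ∘)`. -/
noncomputable def cabledSigma (k : ℤ) (x : X) : Equiv.Perm X :=
  (((k • iota x)⁻¹ : permGroup X) : Equiv.Perm X)

variable (X) in
/-- The map `λ_g : h ↦ -g + g ∘ h`, as an endomorphism of the additive group of `𝒢(X)`. -/
noncomputable def lam (g : permGroup X) : permGroup X →+ permGroup X :=
  AddMonoidHom.mk' (fun h => -g + g * h) fun a b => by
    rw [Brace.mul_add_eq]; abel

theorem mul_eq_add_lam (g h : permGroup X) : g * h = g + lam X g h := by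
  simp [lam]

theorem lam_iota (g : permGroup X) (x : X) : lam X g (iota x) = iota ((g : Equiv.Perm X) x) := by
  have h := mul_eq_add_lam g (iota x)
  have h1 := add_iota g ((g : Equiv.Perm X) x)
  rw [perm_inv_apply_self, h] at h1
  exact (add_left_cancel h1).symm

theorem zero_eq_one : (0 : permGroup X) = 1 := by
  rw [← transOf_one (0 : permGroup X), transOf_apply, zero_add]

/-- `(k σ_x⁻¹) ∘ (k σ_z⁻¹) = k σ_x⁻¹ + k σ_y⁻¹` for `z = x ⬝ₖ y`. -/
theorem zsmul_iota_mul (k : ℤ) (x y : X) :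
    (k • iota x) * (k • iota (cabledSigma k x y)) = k • iota x + k • iota y := by
  rw [mul_eq_add_lam, map_zsmul, lam_iota, cabledSigma, Subgroup.coe_inv,
    perm_apply_inv_self]

theorem inv_zsmul_iota (k : ℤ) (x : X) :
    (k • iota x : permGroup X)⁻¹ = -(k • iota (cabledSigma k x x)) := by
  have h := zsmul_iota_mul k x x
  have h1 := mul_eq_add_lam (k • iota x : permGroup X)⁻¹ (k • iota x)
  rw [inv_mul_cancel, ← zero_eq_one, map_zsmul, lam_iota] at h1
  exact eq_neg_of_add_eq_zero_left h1.symm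

theorem cabledSigma_cycloid (k : ℤ) (x y : X) :
    cabledSigma k (cabledSigma k x y) * cabledSigma k x =
      cabledSigma k (cabledSigma k y x) * cabledSigma k y := by
  have h := zsmul_iota_mul k x y
  rw [add_comm, ← zsmul_iota_mul k y x] at h
  have h1 := congrArg (fun g : permGroup X => ((g⁻¹ : permGroup X) : Equiv.Perm X)) h
  simp only [mul_inv_rev, Subgroup.coe_mul] at h1
  exact h1

theorem cabledSigma_bijective_sq (k : ℤ) :
    Function.Bijective (fun x : X => cabledSigma k x x) := by
  refine ⟨fun x y h => ?_, fun z => ?_⟩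
  · have h1 : cabledSigma k x = cabledSigma k y := by
      unfold cabledSigma
      rw [inv_zsmul_iota, inv_zsmul_iota]
      exact congrArg (fun w : X => ((-(k • iota w) : permGroup X) : Equiv.Perm X)) h
    change cabledSigma k x x = cabledSigma k y y at h
    rw [h1] at h
    exact (cabledSigma k y).injective h
  · let w : X := ((-(k • iota z) : permGroup X) : Equiv.Perm X)⁻¹ z
    refine ⟨w, ?_⟩
    have h : (k • iota w : permGroup X)⁻¹ = -(k • iota z) := by
      have h1 := mul_eq_add_lam (-(k • iota z)) (k • iota w)
      have hw : ((-(k • iota z) : permGroup X) : Equiv.Perm X) w = z :=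
        perm_apply_inv_self _ _
      rw [map_zsmul, lam_iota, hw, neg_add_cancel, zero_eq_one] at h1
      exact (eq_inv_of_mul_eq_one_left h1).symm
    change cabledSigma k w w = z
    rw [cabledSigma, h]
    exact perm_apply_inv_self _ _

variable (X) in
/-- The underlying set of the `k`-cabled cycle set of `X`. -/
def Cabled (_k : ℤ) : Type u := X

instance (k : ℤ) [Finite X] : Finite (Cabled X k) := inferInstanceAs (Finite X)

/-- The `k`-cabled cycle set `(X, ⬝ₖ)`, with `x ⬝ₖ y = (k σ_x⁻¹)⁻¹ (y)`. -/
noncomputable instance cabledCycleSet (k : ℤ) : CycleSet (Cabled X k) where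
  op := fun x y : X => cabledSigma k x y
  cycloid := fun x y z : X => DFunLike.congr_fun (cabledSigma_cycloid k x y) z
  bijective_left := fun x : X => (cabledSigma k x).bijective
  bijective_sq := cabledSigma_bijective_sq (X := X) k

end Basic

/-! ### Retraction and multipermutation level -/

/-- The equivalence relation `σ_x = σ_y` on `X`. -/
noncomputable def retSetoid (X : Type u) [CycleSet X] : Setoid X := Setoid.ker (sigma : X → Equiv.Perm X)

/-- The underlying set of the retraction of `X`. -/
def Ret (X : Type u) [CycleSet X] : Type u := Quotient (retSetoid X)

instance (X : Type u) [CycleSet X] [Finite X] : Finite (Ret X) :=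
  inferInstanceAs (Finite (Quotient (retSetoid X)))

theorem retSetoid_op {X : Type u} [CycleSet X] {x x' y y' : X} (hx : sigma x = sigma x')
    (hy : sigma y = sigma y') : sigma (op x y) = sigma (op x' y') := by
  have h1 : op x y = op x' y := DFunLike.congr_fun hx y
  have h2 : op y x' = op y' x' := DFunLike.congr_fun hy x'
  have h3 := sigma_cycloid x' y
  rw [h2, hy, ← sigma_cycloid x' y'] at h3
  rw [h1]
  exact mul_right_cancel h3

/-- The retraction `Ret(X)` of a finite cycle set: the quotient of `X` by the relation
`σ_x = σ_y`, with the induced operation. -/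
noncomputable instance retCycleSet (X : Type u) [CycleSet X] [Finite X] : CycleSet (Ret X) where
  op := Quotient.map₂ op fun _ _ hx _ _ hy => retSetoid_op hx hy
  cycloid := by
    rintro ⟨x⟩ ⟨y⟩ ⟨z⟩
    exact congrArg (Quotient.mk (retSetoid X)) (cycloid x y z)
  bijective_left := by
    rintro ⟨x⟩
    refine Finite.surjective_iff_bijective.1 ?_
    rintro ⟨z⟩
    obtain ⟨y, hy⟩ := (bijective_left x).2 z
    exact ⟨Quotient.mk (retSetoid X) y, congrArg (Quotient.mk (retSetoid X)) hy⟩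
  bijective_sq := by
    refine Finite.surjective_iff_bijective.1 ?_
    rintro ⟨z⟩
    obtain ⟨y, hy⟩ := (bijective_sq (X := X)).2 z
    exact ⟨Quotient.mk (retSetoid X) y, congrArg (Quotient.mk (retSetoid X)) hy⟩

/-- `RetIterOnePoint m X` says that the `m`-fold iterated retraction `Ret^m(X)` has exactly one
element. -/
def RetIterOnePoint : ℕ → ∀ (X : Type u) [CycleSet X] [Finite X], Prop
  | 0, X, _, _ => Nat.card X = 1
  | m + 1, X, _, _ => RetIterOnePoint m (Ret X)

/-- `X` has finite multipermutation level: some iterated retraction of `X` has one element. -/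
def HasFiniteMultipermutationLevel (X : Type u) [CycleSet X] [Finite X] : Prop :=
  ∃ m : ℕ, RetIterOnePoint m X

end CycleSet

/-!
Write `|𝒢(X)| = q k` with `q` a power of `p`. Since the maps `λ_g : h ↦ -g + g ∘ h` are automorphisms
of the additive group, its torsion subgroups `P` (for `q`) and `H` (for `k`) are also subgroups of
`(𝒢(X), ∘)`, of coprime orders, and `H` together with the elements `k σ_x⁻¹` of `P` generates
`𝒢(X)`. They are linked by the exchange law `h ∘ a = λ_h(a) ∘ h'` with `h' ∈ H` whenever `h ∈ H`.
The aim is to show that `H` acts trivially on `X`.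

Let `E i` be the relation on `X` of having the same image in `Ret^i(X, ⬝ₖ)` (`cabledRel`).

* Each `E i` is preserved by all of `𝒢(X)` (`cabledRel_smul`). By the exchange law, the failure of
  `h ∈ H` to preserve `E (i + 1)` is measured by an element of `P` which acts on `X / E i` like an
  element of `H`; by coprimality it acts trivially.
* If `H` acts trivially on `X / E (i + 1)`, then it does so on `X / E i`
  (`cabledRel_smul_self_of_succ`). The exchange law shows that the image of `H` in `Sym (X / E i)`
  is normalized by `𝒢(X)`. As `X` is indecomposable, `𝒢(X)` is transitive on `X / E i`, so that all
  orbits of `H` there have the same size. It divides both `|X|`, a power of `p`, and `|H|`, hence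
  is `1`.

Finite multipermutation level says that `X / E m` is a point for some `m`. Descending to `E 0`, which
is equality, gives `H = 1`, so `(𝒢(X), +)` has no `k`-torsion.
-/

/-! ### Group actions modulo an invariant equivalence relation -/

/-- The action induced on the quotient by an equivalence relation that is preserved by `G`. -/
@[reducible]
def MulAction.quotientOfInvariant {G α : Type*} [Group G] [MulAction G α] (r : Setoid α)
    (hr : ∀ (g : G) (x y : α), r x y → r (g • x) (g • y)) : MulAction G (Quotient r) where
  smul g := Quotient.map (g • ·) fun x y h => hr g x y h
  one_smul := by
    rintro ⟨x⟩
    exact congrArg (Quotient.mk r) (one_smul G x)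
  mul_smul := by
    rintro g h ⟨x⟩
    exact congrArg (Quotient.mk r) (mul_smul g h x)

/-- Two group elements of coprime orders which act in the same way modulo an invariant relation
both act trivially modulo it. -/
theorem MulAction.rel_smul_self_of_coprime {G α : Type*} [Group G] [MulAction G α]
    (r : Setoid α) (hr : ∀ (g : G) (x y : α), r x y → r (g • x) (g • y)) {u v : G}
    (huv : (orderOf u).Coprime (orderOf v)) (h : ∀ x : α, r (u • x) (v • x)) (x : α) :
    r (u • x) x := by
  let _ := MulAction.quotientOfInvariant r hr
  let φ : G →* Equiv.Perm (Quotient r) := MulAction.toPermHom G (Quotient r)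
  have huv' : φ u = φ v := by
    ext ⟨x⟩
    exact Quotient.sound (h x)
  have h1 : φ u = 1 := by
    rw [← orderOf_eq_one_iff]
    refine Nat.eq_one_of_dvd_coprimes huv (orderOf_map_dvd φ u) ?_
    rw [huv']
    exact orderOf_map_dvd φ v
  exact Quotient.exact (DFunLike.congr_fun h1 (Quotient.mk r x))

open scoped Pointwise in
/-- If `|α|` and `|H|` are coprime, then `H` acts trivially as soon as its image is normal: the
orbits of `H` are then blocks, so their common size divides both `|α|` and `|H|`. -/
theorem MulAction.smul_eq_of_coprime_of_normalizes {G α : Type*} [Group G] [MulAction G α]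
    [MulAction.IsPretransitive G α] (H : Subgroup G)
    (hcop : (Nat.card α).Coprime (Nat.card H))
    (hH : ∀ g : G, ∀ h ∈ H, ∃ h' ∈ H, ∀ x : α, h • g • x = g • h' • x)
    {h : G} (hh : h ∈ H) (x : α) : h • x = x := by
  have hsub : ∀ (g : G) (y : α), MulAction.orbit H (g • y) ⊆ g • MulAction.orbit H y := by
    rintro g y _ ⟨⟨h, hh⟩, rfl⟩
    obtain ⟨h', hh', e⟩ := hH g h hh
    exact ⟨h' • y, ⟨⟨h', hh'⟩, rfl⟩, (e y).symm⟩
  have heq : ∀ (g : G) (y : α), g • MulAction.orbit H y = MulAction.orbit H (g • y) := by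
    refine fun g y => Set.Subset.antisymm ?_ (hsub g y)
    have := hsub g⁻¹ (g • y)
    rwa [inv_smul_smul, Set.subset_smul_set_iff, inv_inv] at this
  have hB : MulAction.IsBlock G (MulAction.orbit H x) := by
    intro g₁ g₂ hne
    rw [heq, heq] at hne ⊢
    exact (MulAction.orbit.eq_or_disjoint _ _).resolve_left hne
  have h1 := hB.ncard_dvd_card (MulAction.nonempty_orbit x)
  have h2 : (MulAction.orbit H x).ncard ∣ Nat.card H := by
    rw [← MulAction.index_stabilizer]
    exact Subgroup.index_dvd_card _
  obtain ⟨y, hy⟩ := Set.ncard_eq_one.1 (Nat.eq_one_of_dvd_coprimes hcop h1 h2)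
  have e1 : h • x = y := by
    have : h • x ∈ MulAction.orbit H x := ⟨⟨h, hh⟩, rfl⟩
    rwa [hy] at this
  have e2 : x = y := by
    have := MulAction.mem_orbit_self (M := H) x
    rwa [hy] at this
  rw [e1, ← e2]

/-- The relative form of `MulAction.smul_eq_of_coprime_of_normalizes`, on the quotient by an
invariant relation; transitivity makes the size of this quotient a divisor of `|α|`. -/
theorem MulAction.rel_smul_self_of_normalizes {G α : Type*} [Group G] [MulAction G α]
    [MulAction.IsPretransitive G α] (r : Setoid α)
    (hr : ∀ (g : G) (x y : α), r x y → r (g • x) (g • y)) (H : Subgroup G)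
    (hcop : (Nat.card α).Coprime (Nat.card H))
    (hH : ∀ g : G, ∀ h ∈ H, ∃ h' ∈ H, ∀ x : α, r (h • g • x) (g • h' • x))
    {h : G} (hh : h ∈ H) (x : α) : r (h • x) x := by
  let _ := MulAction.quotientOfInvariant r hr
  have : MulAction.IsPretransitive G (Quotient r) := by
    refine ⟨?_⟩
    rintro ⟨y⟩ ⟨z⟩
    obtain ⟨g, hg⟩ := MulAction.exists_smul_eq G y z
    exact ⟨g, congrArg (Quotient.mk r) hg⟩
  have hdvd : Nat.card (Quotient r) ∣ Nat.card α := by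
    rw [← MulAction.index_stabilizer_of_transitive G (Quotient.mk r x),
      ← MulAction.index_stabilizer_of_transitive G x]
    refine Subgroup.index_dvd_of_le fun g hg => ?_
    exact congrArg (Quotient.mk r) (MulAction.mem_stabilizer_iff.1 hg)
  refine Quotient.exact (MulAction.smul_eq_of_coprime_of_normalizes H
    (hcop.coprime_dvd_left hdvd) ?_ hh (Quotient.mk r x))
  intro g h hh
  obtain ⟨h', hh', e⟩ := hH g h hh
  refine ⟨h', hh', ?_⟩
  rintro ⟨y⟩
  exact Quotient.sound (e y)

namespace CycleSet

/-! ### The iterated retraction as a chain of relations on the cycle set -/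

/-- The relation "`x` and `y` have the same image in `Ret^i(W)`", written without quotients: at level
`i + 1` it asks that `σ_x` and `σ_y` agree up to the relation of level `i`. -/
def retRel {W : Type u} [CycleSet W] : ℕ → W → W → Prop
  | 0, x, y => x = y
  | i + 1, x, y => ∀ z, retRel i (op x z) (op y z)

theorem retRel_equivalence {W : Type u} [CycleSet W] (i : ℕ) :
    Equivalence (retRel i : W → W → Prop) := by
  induction i with
  | zero => exact eq_equivalence
  | succ i ih =>
    exact ⟨fun x z => ih.refl _, fun h z => ih.symm (h z), fun h h' z => ih.trans (h z) (h' z)⟩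

/-- `retRel i` as a `Setoid`. -/
def retRelSetoid (W : Type u) [CycleSet W] (i : ℕ) : Setoid W := ⟨retRel i, retRel_equivalence i⟩

theorem retRel_succ_of_retRel {W : Type u} [CycleSet W] {i : ℕ} {x y : W} (h : retRel i x y) :
    retRel (i + 1) x y := by
  induction i generalizing x y with
  | zero =>
    obtain rfl : x = y := h
    exact (retRel_equivalence 1).refl x
  | succ i ih => exact fun z => ih (h z)

/-- Left translations preserve `retRel i`; for the induction step, rewrite `(w ⬝ x) ⬝ (w ⬝ z)` as
`(x ⬝ w) ⬝ (x ⬝ z)`. -/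
theorem retRel_op {W : Type u} [CycleSet W] {i : ℕ} (w : W) {x y : W} (h : retRel i x y) :
    retRel i (op w x) (op w y) := by
  induction i generalizing x y w with
  | zero => exact congrArg (op w) h
  | succ i ih =>
    intro z
    obtain ⟨z, rfl⟩ := (bijective_left w).2 z
    rw [cycloid w x z, cycloid w y z]
    exact (retRel_equivalence i).trans (ih _ (h z)) (retRel_succ_of_retRel (h w) _)

theorem retRel_succ_iff {W : Type u} [CycleSet W] [Finite W] (i : ℕ) (x y : W) :
    retRel (i + 1) x y ↔
      retRel (W := Ret W) i (Quotient.mk (retSetoid W) x) (Quotient.mk (retSetoid W) y) := by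
  induction i generalizing x y with
  | zero =>
    constructor
    · intro h
      exact Quotient.sound (show sigma x = sigma y from Equiv.ext h)
    · intro h z
      have h' : sigma x = sigma y := Quotient.exact h
      exact DFunLike.congr_fun h' z
  | succ i ih =>
    constructor
    · rintro h ⟨z⟩
      exact (ih _ _).1 (h z)
    · intro h z
      exact (ih _ _).2 (h (Quotient.mk (retSetoid W) z))

theorem retRel_of_retIterOnePoint (m : ℕ) {W : Type u} [CycleSet W] [Finite W]
    (h : RetIterOnePoint m W) (x y : W) : retRel m x y := by
  induction m generalizing W with
  | zero =>
    have := (Nat.card_eq_one_iff_unique.1 (show Nat.card W = 1 from h)).1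
    exact Subsingleton.elim x y
  | succ m ih => exact (retRel_succ_iff m x y).2 (ih (W := Ret W) h _ _)

/-! ### The permutation group and its additive torsion -/

section

variable {X : Type u} [CycleSet X]

theorem isPretransitive_of_indecomposable (hind : Indecomposable X) :
    MulAction.IsPretransitive (permGroup X) X := by
  refine ⟨fun x y => ?_⟩
  by_contra hxy
  have hmem : ∀ a b : X, op a b ∈ MulAction.orbit (permGroup X) b := fun a b =>
    ⟨⟨sigma a, Subgroup.subset_closure ⟨a, rfl⟩⟩, rfl⟩
  refine hind ⟨MulAction.orbit (permGroup X) x, (MulAction.orbit (permGroup X) x)ᶜ,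
    ⟨x, MulAction.mem_orbit_self x⟩, ⟨y, hxy⟩, disjoint_compl_right, Set.union_compl_self _,
    fun a _ b hb => ?_, fun a _ b hb hab => hb ?_⟩
  · rw [← MulAction.orbit_eq_iff.2 hb]
    exact hmem a b
  · rw [← MulAction.orbit_eq_iff.2 hab, MulAction.orbit_eq_iff.2 (hmem a b)]
    exact MulAction.mem_orbit_self b

theorem eq_zero_of_lam_eq_zero {g y : permGroup X} (h : lam X g y = 0) : y = 0 := by
  have h1 := mul_eq_add_lam g y
  rw [h, add_zero] at h1
  rw [zero_eq_one]
  exact mul_eq_left.1 h1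

theorem nsmul_lam_eq_zero_iff {m : ℕ} {g y : permGroup X} : m • lam X g y = 0 ↔ m • y = 0 := by
  rw [← map_nsmul]
  exact ⟨eq_zero_of_lam_eq_zero, fun h => by rw [h, map_zero]⟩

variable (X) in
/-- The `m`-torsion of `(𝒢(X), +)`. It is stable under all maps `λ_g`, hence is also a subgroup of
`(𝒢(X), ∘)`. -/
def addTorsion (m : ℕ) : Subgroup (permGroup X) where
  carrier := {g | m • g = 0}
  one_mem' := by
    rw [← zero_eq_one]
    exact smul_zero m
  mul_mem' {g h} hg hh := by
    change m • (g * h) = 0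
    rw [mul_eq_add_lam, smul_add, nsmul_lam_eq_zero_iff.2 hh, add_zero]
    exact hg
  inv_mem' {g} hg := by
    have h1 := mul_eq_add_lam g g⁻¹
    rw [mul_inv_cancel, ← zero_eq_one] at h1
    change m • g⁻¹ = 0
    rw [← nsmul_lam_eq_zero_iff (g := g), eq_neg_of_add_eq_zero_right h1.symm, smul_neg, neg_eq_zero]
    exact hg

theorem mem_addTorsion {m : ℕ} {g : permGroup X} : g ∈ addTorsion X m ↔ m • g = 0 := Iff.rfl

/-- By Cauchy's theorem in the additive group, every prime divisor of the order of the `m`-torsion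
divides `m`. -/
theorem coprime_card_addTorsion [Finite X] {m r : ℕ} (h : m.Coprime r) :
    (Nat.card (addTorsion X m)).Coprime r := by
  let T : AddSubgroup (permGroup X) := (nsmulAddMonoidHom m : permGroup X →+ permGroup X).ker
  refine Nat.coprime_of_dvd fun ℓ hℓ hdvd hr => hℓ.not_dvd_one ?_
  have : Fact ℓ.Prime := ⟨hℓ⟩
  obtain ⟨t, ht⟩ := exists_prime_addOrderOf_dvd_card' (G := T) ℓ hdvd
  have htm : m • t = 0 := Subtype.ext t.2
  rw [← h.gcd_eq_one]
  exact Nat.dvd_gcd (ht ▸ addOrderOf_dvd_of_nsmul_eq_zero htm) hr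

/-- The exchange law `g ∘ a = λ_g(a) ∘ g'`: if `g` is `m`-torsion, so is `g'`. -/
theorem inv_lam_mul_mul_mem_addTorsion {m : ℕ} {g : permGroup X} (hg : g ∈ addTorsion X m)
    (a : permGroup X) : (lam X g a)⁻¹ * (g * a) ∈ addTorsion X m := by
  set c := lam X g a with hc
  have h1 := mul_eq_add_lam c (c⁻¹ * (g * a))
  have h2 : g * a = c + g := by rw [mul_eq_add_lam, add_comm]
  rw [mul_inv_cancel_left] at h1
  rw [mem_addTorsion, ← nsmul_lam_eq_zero_iff (g := c), ← add_left_cancel (h2.symm.trans h1)]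
  exact hg

theorem lam_zsmul_iota (g : permGroup X) (k : ℤ) (x : X) :
    lam X g (k • iota x) = k • iota (g • x) := by
  rw [map_zsmul, lam_iota]
  rfl

/-- Every multiple `k g` is a product of elements `k σ_x⁻¹`. -/
theorem zsmul_mem_closure (k : ℤ) (g : permGroup X) :
    k • g ∈ Subgroup.closure (Set.range fun x : X => k • iota x) := by
  have hmem : ∀ x : X, k • iota x ∈ Subgroup.closure (Set.range fun x : X => k • iota x) :=
    fun x => Subgroup.subset_closure ⟨x, rfl⟩
  have hmul : ∀ (u : permGroup X) (x : X),
      k • (u * iota x) = (k • u) * (k • iota ((k • u)⁻¹ • u • x)) := by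
    intro u x
    rw [mul_eq_add_lam (k • u), lam_zsmul_iota, smul_inv_smul, mul_eq_add_lam u, lam_iota, smul_add]
    rfl
  obtain ⟨g, hg⟩ := g
  change g ∈ Subgroup.closure _ at hg
  induction hg using Subgroup.closure_induction_right with
  | one =>
    have : k • (⟨1, one_mem _⟩ : permGroup X) = 1 := by
      rw [← zero_eq_one]
      exact (congrArg (k • ·) zero_eq_one.symm).trans (smul_zero k)
    rw [this]
    exact one_mem _
  | mul_right a ha b hb ih =>
    obtain ⟨x, rfl⟩ := hb
    have h := hmul ⟨a * sigma x, mul_mem ha (Subgroup.subset_closure ⟨x, rfl⟩)⟩ x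
    have e : (⟨a * sigma x, mul_mem ha (Subgroup.subset_closure ⟨x, rfl⟩)⟩ : permGroup X) * iota x
        = ⟨a, ha⟩ := Subtype.ext (mul_inv_cancel_right a (sigma x))
    rw [e] at h
    rw [← mul_inv_eq_iff_eq_mul.2 h]
    exact mul_mem ih (inv_mem (hmem _))
  | mul_inv_cancel a ha b hb ih =>
    obtain ⟨x, rfl⟩ := hb
    have h := hmul ⟨a, ha⟩ x
    have e : (⟨a * (sigma x)⁻¹, mul_mem ha (inv_mem (Subgroup.subset_closure ⟨x, rfl⟩))⟩ :
      permGroup X) = ⟨a, ha⟩ * iota x := rfl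
    rw [e, h]
    exact mul_mem ih (hmem _)

/-- If `|𝒢(X)| = q k` with `q` and `k` coprime, then `𝒢(X)` is generated by its `k`-torsion and the
elements `k σ_x⁻¹`. -/
theorem closure_addTorsion_union_eq_top {q k : ℕ} (hcard : Nat.card (permGroup X) = q * k)
    (hqk : q.Coprime k) :
    Subgroup.closure ((addTorsion X k : Set (permGroup X)) ∪
      Set.range fun x : X => (k : ℤ) • iota x) = ⊤ := by
  refine eq_top_iff.2 fun g _ => ?_
  -- Bézout splits `g` into a multiple of `k` and an element of the `k`-torsion.
  have hbez : (1 : ℤ) = q * q.gcdA k + k * q.gcdB k := by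
    rw [← Nat.gcd_eq_gcd_ab, hqk.gcd_eq_one, Nat.cast_one]
  set u : permGroup X := (k : ℤ) • q.gcdB k • g with hu
  set v : permGroup X := (q * q.gcdA k : ℤ) • g with hv
  have hg : g = u + v := by
    rw [hu, hv, ← mul_smul, ← add_smul, add_comm, ← hbez, one_smul]
  have hvk : v ∈ addTorsion X k := by
    rw [mem_addTorsion, hv, ← natCast_zsmul, ← mul_smul,
      show (k : ℤ) * (q * q.gcdA k) = q.gcdA k * ((q * k : ℕ) : ℤ) by push_cast; ring, mul_smul,
      natCast_zsmul, ← hcard, card_nsmul_eq_zero', smul_zero]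
  have hw : u⁻¹ * g ∈ addTorsion X k := by
    have h1 := mul_eq_add_lam u (u⁻¹ * g)
    rw [mul_inv_cancel_left] at h1
    rw [mem_addTorsion, ← nsmul_lam_eq_zero_iff (g := u), ← add_left_cancel (hg.symm.trans h1)]
    exact hvk
  rw [← mul_inv_cancel_left u g]
  refine mul_mem ?_ (Subgroup.subset_closure (Or.inl hw))
  exact Subgroup.closure_mono Set.subset_union_right (zsmul_mem_closure _ _)

/-! ### Retraction relations of a cabling -/

variable (X) in
/-- The relation "same image in `Ret^i(X, ⬝ₖ)`", as a relation on `X`. -/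
noncomputable def cabledRel (k : ℤ) (i : ℕ) : Setoid X := retRelSetoid (Cabled X k) i

theorem cabledRel_succ {k : ℤ} {i : ℕ} {x y : X} :
    cabledRel X k (i + 1) x y ↔
      ∀ z, cabledRel X k i ((k • iota x)⁻¹ • z) ((k • iota y)⁻¹ • z) := Iff.rfl

/-- Induction over the generators of `closure_addTorsion_union_eq_top`; since the group is finite,
inverses need no separate case. -/
theorem torsion_induction [Finite X] {q k : ℕ} (hcard : Nat.card (permGroup X) = q * k)
    (hqk : q.Coprime k) {C : permGroup X → Prop} (torsion : ∀ g ∈ addTorsion X k, C g)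
    (iota : ∀ x : X, C ((k : ℤ) • iota x)) (mul : ∀ g h, C g → C h → C (g * h))
    (g : permGroup X) : C g := by
  have hg : g ∈ (Subgroup.closure ((addTorsion X k : Set (permGroup X)) ∪
      Set.range fun x : X => (k : ℤ) • CycleSet.iota x)).toSubmonoid := by
    rw [closure_addTorsion_union_eq_top hcard hqk]
    trivial
  rw [Subgroup.closure_toSubmonoid_of_finite] at hg
  induction hg using Submonoid.closure_induction with
  | mem g hg =>
    obtain hg | ⟨x, rfl⟩ := hg
    exacts [torsion g hg, iota x]
  | one => exact torsion 1 (one_mem _)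
  | mul g h _ _ hg hh => exact mul g h hg hh

theorem cabledRel_inv_smul [Finite X] {k : ℤ} {i : ℕ} (w : X) {x y : X}
    (h : cabledRel X k i x y) :
    cabledRel X k i ((k • iota w)⁻¹ • x) ((k • iota w)⁻¹ • y) :=
  retRel_op (W := Cabled X k) w h

/-- All the relations `cabledRel X k i` are preserved by `𝒢(X)`, not only by the permutation group of
the cabling. For `g` in the `k`-torsion and `x`, `y` related at level `i + 1`, the element
`(λ_g(k σ_y⁻¹))⁻¹ ∘ λ_g(k σ_x⁻¹)` of the `q`-torsion acts at level `i` like an element of the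
`k`-torsion, hence trivially. -/
theorem cabledRel_smul [Finite X] {q k : ℕ} (hcard : Nat.card (permGroup X) = q * k)
    (hqk : q.Coprime k) (i : ℕ) (g : permGroup X) (x y : X) (hxy : cabledRel X k i x y) :
    cabledRel X k i (g • x) (g • y) := by
  induction i generalizing g x y with
  | zero => exact congrArg (g • ·) hxy
  | succ i ih =>
    refine torsion_induction hcard hqk (C := fun g => ∀ x y, cabledRel X k (i + 1) x y →
      cabledRel X k (i + 1) (g • x) (g • y)) ?_ ?_ ?_ g x y hxy
    · intro g hg x y hxy
      rw [cabledRel_succ]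
      set a : permGroup X := (k : ℤ) • iota x with ha
      set b : permGroup X := (k : ℤ) • iota y with hb
      rw [← lam_zsmul_iota, ← lam_zsmul_iota, ← ha, ← hb]
      set c := lam X g a with hc
      set d := lam X g b with hd
      have hgen : ∀ w : X, (k : ℤ) • iota w ∈ addTorsion X q := fun w => by
        rw [mem_addTorsion, ← natCast_zsmul, ← mul_smul, ← Nat.cast_mul, ← hcard, natCast_zsmul,
          card_nsmul_eq_zero']
      have hu : d⁻¹ * c ∈ addTorsion X q := by
        rw [hc, hd, ha, hb, lam_zsmul_iota, lam_zsmul_iota]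
        exact mul_mem (inv_mem (hgen _)) (hgen _)
      have hv : (d⁻¹ * (g * b)) * (c⁻¹ * (g * a))⁻¹ ∈ addTorsion X k :=
        mul_mem (inv_lam_mul_mul_mem_addTorsion hg b)
          (inv_mem (inv_lam_mul_mul_mem_addTorsion hg a))
      have hcop : (orderOf (d⁻¹ * c)).Coprime
          (orderOf ((d⁻¹ * (g * b)) * (c⁻¹ * (g * a))⁻¹)) :=
        ((coprime_card_addTorsion (coprime_card_addTorsion hqk).symm).symm.coprime_dvd_left
          (Subgroup.orderOf_dvd_natCard _ hu)).coprime_dvd_right (Subgroup.orderOf_dvd_natCard _ hv)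
      intro z
      have key := MulAction.rel_smul_self_of_coprime _ ih hcop (fun w => ?_) (c⁻¹ • z)
      · rw [← mul_smul, mul_assoc, mul_inv_cancel, mul_one] at key
        exact (cabledRel X k i).symm key
      · -- Both sides differ only in whether `a⁻¹` or `b⁻¹` acts on `g⁻¹ c w`.
        have h1 := ih (d⁻¹ * (g * b)) _ _ (cabledRel_succ.1 hxy ((g⁻¹ * c) • w))
        simp only [← mul_smul] at h1
        rw [show d⁻¹ * (g * b) * (b⁻¹ * (g⁻¹ * c)) = d⁻¹ * c by group,
          show d⁻¹ * (g * b) * (a⁻¹ * (g⁻¹ * c)) = d⁻¹ * (g * b) * (c⁻¹ * (g * a))⁻¹ by group] at h1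
        exact (cabledRel X k i).symm h1
    · -- In a finite group the inverse of a permutation preserving a relation preserves it.
      intro w x y hxy
      have hpow : ∀ j : ℕ, cabledRel X k (i + 1) ((((k : ℤ) • iota w)⁻¹ ^ j) • x)
          ((((k : ℤ) • iota w)⁻¹ ^ j) • y) := by
        intro j
        induction j with
        | zero => simpa using hxy
        | succ j hj =>
          rw [pow_succ', mul_smul, mul_smul]
          exact cabledRel_inv_smul w hj
      obtain ⟨j, hj⟩ : ∃ j : ℕ, (((k : ℤ) • iota w)⁻¹ : permGroup X) ^ j = (k : ℤ) • iota w := by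
        refine ⟨orderOf ((k : ℤ) • iota w : permGroup X) - 1, ?_⟩
        rw [inv_pow, inv_eq_iff_mul_eq_one, ← pow_succ, Nat.sub_add_cancel (orderOf_pos _),
          pow_orderOf_eq_one]
      rw [← hj]
      exact hpow j
    · intro g h hg hh x y hxy
      rw [mul_smul, mul_smul]
      exact hg _ _ (hh _ _ hxy)

/-- If the `k`-torsion acts trivially at level `i + 1`, then `λ_g(k σ_x⁻¹)` and `k σ_x⁻¹` agree at
level `i` for every `k`-torsion element `g`. By the exchange law the image of the `k`-torsion at
level `i` is then normal, so it acts trivially there as well. -/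
theorem cabledRel_smul_self_of_succ [Finite X] [MulAction.IsPretransitive (permGroup X) X]
    {q k : ℕ} (hcard : Nat.card (permGroup X) = q * k) (hqk : q.Coprime k)
    (hcop : (Nat.card X).Coprime k) {i : ℕ}
    (h : ∀ g ∈ addTorsion X k, ∀ x, cabledRel X k (i + 1) (g • x) x)
    {g : permGroup X} (hg : g ∈ addTorsion X k) (x : X) : cabledRel X k i (g • x) x := by
  refine MulAction.rel_smul_self_of_normalizes (cabledRel X k i) (cabledRel_smul hcard hqk i)
    (addTorsion X k) (coprime_card_addTorsion hcop.symm).symm (fun u => ?_) hg x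
  refine torsion_induction hcard hqk (C := fun u => ∀ g ∈ addTorsion X k, ∃ g' ∈ addTorsion X k,
    ∀ z, cabledRel X k i (g • u • z) (u • g' • z)) ?_ ?_ ?_ u
  · intro u hu g hg
    refine ⟨u⁻¹ * g * u, mul_mem (mul_mem (inv_mem hu) hg) hu, fun z => ?_⟩
    rw [← mul_smul, ← mul_smul, mul_assoc, mul_inv_cancel_left]
  · intro w g hg
    set a : permGroup X := (k : ℤ) • iota w with ha
    refine ⟨_, inv_lam_mul_mul_mem_addTorsion hg a, fun z => ?_⟩
    have h1 := cabledRel_smul hcard hqk i a _ _ (cabledRel_succ.1 (h g hg w) ((g * a) • z))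
    rw [← lam_zsmul_iota, ← ha, smul_inv_smul, ← mul_smul _ (g * a)] at h1
    rw [← mul_smul g a z]
    exact (cabledRel X k i).symm h1
  · intro u v hu hv g hg
    obtain ⟨g', hg', e⟩ := hu g hg
    obtain ⟨g'', hg'', e'⟩ := hv g' hg'
    refine ⟨g'', hg'', fun z => ?_⟩
    rw [mul_smul, mul_smul]
    exact (cabledRel X k i).trans (e _) (cabledRel_smul hcard hqk i u _ _ (e' z))

/-- The `k`-torsion is trivial if the cabling by `k` has finite multipermutation level. -/
theorem addTorsion_eq_bot [Finite X] [MulAction.IsPretransitive (permGroup X) X]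
    {q k : ℕ} (hcard : Nat.card (permGroup X) = q * k) (hqk : q.Coprime k)
    (hcop : (Nat.card X).Coprime k)
    (hmpl : HasFiniteMultipermutationLevel (Cabled X (k : ℤ))) : addTorsion X k = ⊥ := by
  obtain ⟨m, hm⟩ := hmpl
  have h0 : ∀ i, (∀ g ∈ addTorsion X k, ∀ x, cabledRel X k i (g • x) x) →
      ∀ g ∈ addTorsion X k, ∀ x, cabledRel X k 0 (g • x) x := by
    intro i
    induction i with
    | zero => exact id
    | succ i ih =>
      exact fun h => ih fun g hg x => cabledRel_smul_self_of_succ hcard hqk hcop h hg x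
  refine (Subgroup.eq_bot_iff_forall _).2 fun g hg => ?_
  refine Subtype.ext (Equiv.ext fun x => ?_)
  exact h0 m (fun g _ x => retRel_of_retIterOnePoint m hm _ _) g hg x

end

end CycleSet

theorem mainTheorem10 {X : Type u} [CycleSet X] [Finite X] (p n : ℕ) (hp : p.Prime)
    (hX : Nat.card X = p ^ n) (hind : CycleSet.Indecomposable X) (k : ℕ)
    (hk : IsGreatest {d : ℕ | d ∣ Nat.card (CycleSet.permGroup X) ∧ d.Coprime p} k)
    (hmpl : CycleSet.HasFiniteMultipermutationLevel (CycleSet.Cabled X (k : ℤ))) :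
    IsPGroup p (CycleSet.permGroup X) ∧ k = 1 := by
  have := CycleSet.isPretransitive_of_indecomposable hind
  obtain ⟨⟨hkdvd, hkp⟩, hmax⟩ := hk
  obtain ⟨a, m, hpm, hcard⟩ := Nat.exists_eq_pow_mul_and_not_dvd
    (Nat.card_pos (α := CycleSet.permGroup X)).ne' p hp.ne_one
  -- By maximality, `k` is the full prime-to-`p` part `m` of the order.
  have hmk : m = k := by
    refine le_antisymm (hmax ⟨hcard ▸ dvd_mul_left _ _,
      ((hp.coprime_iff_not_dvd).2 hpm).symm⟩) (Nat.le_of_dvd ?_ ?_)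
    · exact Nat.pos_of_ne_zero fun h => hpm (h ▸ dvd_zero p)
    · rw [hcard] at hkdvd
      exact (Nat.Coprime.pow_right a hkp).dvd_of_dvd_mul_left hkdvd
  rw [hmk] at hcard
  have hqk : (p ^ a).Coprime k := (Nat.Coprime.pow_right a hkp).symm
  have hbot := CycleSet.addTorsion_eq_bot hcard hqk
    (hX ▸ (Nat.Coprime.pow_right n hkp).symm) hmpl
  -- Hence the `p ^ a`-torsion is everything, and the order is prime to `k`.
  have htop : CycleSet.addTorsion X (p ^ a) = ⊤ := by
    refine eq_top_iff.2 fun g _ => ?_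
    have hg : p ^ a • g ∈ CycleSet.addTorsion X k := by
      rw [CycleSet.mem_addTorsion, ← mul_nsmul, ← hcard, card_nsmul_eq_zero']
    rw [hbot, Subgroup.mem_bot, ← CycleSet.zero_eq_one] at hg
    exact hg
  have hcop := CycleSet.coprime_card_addTorsion (X := X) hqk
  rw [htop, Subgroup.card_top] at hcop
  have hk1 : k = 1 := Nat.eq_one_of_dvd_coprimes hcop hkdvd dvd_rfl
  refine ⟨IsPGroup.of_card (n := a) ?_, hk1⟩
  rw [hcard, hk1, mul_one]
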